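/- Let $F=\mathbb F_q$ be a finite field, $V$ an $F$-vector space with basis $b_1,\dots,b_n$, and let $\mathcal X=(X_1,\dots,X_k)$ be a family of subspaces of $V$ with $X_i=\langle b_j : j\in L_i\rangle$ for some sets $L_i\subseteq\{1,\dots,n\}$. A $q$-matroid on $V$ is given by a non-negative integer valued rank function $r$ on the subspaces of $V$ with $r(A)\le\dim A$, $r(A)\le r(B)$ for $A\le B$, and $r(A+B)+r(A\cap B)\le r(A)+r(B)$; a subspace $A$ is independent if $r(A)=\dim A$. A subspace $T\le V$ is a partial $q$-transversal of $\mathcal X$ if for every basis $t_1,\dots,t_m$ of $T$ there is an injection $\pi:\{1,\dots,m\}\to\{1,\dots,k\}$ with $t_j\notin X_{\pi(j)}$ for all $j$. The $q$-transversal matroid $M$ of $\mathcal X$ is the $q$-matroid on $V$ whose independent subspaces are the partial $q$-transversals; the rank of $A$ is the largest dimension of a partial $q$-transversal contained in $A$. A matrix $G$ with $n$ columns over an extension field $K$ of $F$ represents a $q$-matroid on $V$ with respect to a given basis of $V$ if, for every matrix $S$ over $F$ with $n$ columns, the subspace spanned by the vectors whose coordinates in that basis are the rows of $S$ has rank $\operatorname{rank}(GS^{T})$.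 A $q$-matroid is representable (over $K$) if such a $G$ exists for some basis (with entries in $K$, respectively in some extension field of $F$). Then: 1. $M$ is representable. Explicitly, over the field of rational functions $K=F(y_1,\dots,y_k)$, $M$ is represented with respect to $b_1,\dots,b_n$ by the $k\times n$ matrix $G$ with $G_{ij}=0$ if $j\in L_i$ and $G_{ij}=y_i^{\,j}$ otherwise. 2. If $\alpha\neq0$ is an element of degree $n^k$ over $F$ of any extension field of $F$, then $M$ is also represented with respect to $b_1,\dots,b_n$ by the matrix with entries $0$ if $j\in L_i$ and $\alpha^{\,j n^{i-1}}$ otherwise. Consequently $M$ is representable over every extension of $F$ of degree $n^k$, and if $n\ge1$ such an extension exists. -/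

import Mathlib

open Module

universe u v w

/-- A `q`-matroid on a vector space `V`: a rank function on the lattice of subspaces of `V` that is
non-negative, bounded by the dimension, non-decreasing and submodular. -/
@[ext]
structure QMatroid (F V : Type*) [Field F] [AddCommGroup V] [Module F V] where
  rank : Submodule F V → ℕ
  rank_le : ∀ A, rank A ≤ finrank F A
  mono : ∀ A B, A ≤ B → rank A ≤ rank B
  submod : ∀ A B, rank (A ⊔ B) + rank (A ⊓ B) ≤ rank A + rank B

/-- A subspace is independent in a `q`-matroid if its rank equals its dimension. -/
def QMatroid.Indep {F V : Type*} [Field F] [AddCommGroup V] [Module F V]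
    (M : QMatroid F V) (A : Submodule F V) : Prop :=
  M.rank A = finrank F A

/-- `T` is a partial `q`-transversal of the family `X` if every vector basis of `T` is a partial
avoiding transversal of `X`: its elements can be matched injectively with members of the family
that do not contain them. -/
def IsPartialQTransversal {F V : Type*} [Field F] [AddCommGroup V] [Module F V] {k : ℕ}
    (X : Fin k → Submodule F V) (T : Submodule F V) : Prop :=
  ∀ B : Basis (Fin (finrank F T)) F T, ∃ p : Fin (finrank F T) → Fin k,
    Function.Injective p ∧ ∀ j, (B j : V) ∉ X (p j)

/-- The `q`-matroid `M` on `V` is represented by the matrix `G` over the extension `K` of `F`, with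
respect to the coordinates on `V` given by the basis `b`: whenever a subspace of `V` is the row
space of a matrix `S` over `F`, its rank is the rank of `G * Sᵀ` over `K`. -/
def QMatroid.IsRepresentedBy {F V K : Type*} [Field F] [AddCommGroup V] [Module F V]
    [Field K] [Algebra F K] {k n : ℕ}
    (M : QMatroid F V) (b : Basis (Fin n) F V) (G : Matrix (Fin k) (Fin n) K) : Prop :=
  ∀ (m : ℕ) (S : Matrix (Fin m) (Fin n) F),
    M.rank (Submodule.span F (Set.range fun i => b.equivFun.symm (S i))) =
      (G * (S.map (algebraMap F K)).transpose).rank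

/-- `M` is representable over the extension field `K` of `F`. -/
def QMatroid.RepresentableOver {F V : Type*} [Field F] [AddCommGroup V] [Module F V]
    (M : QMatroid F V) (K : Type*) [Field K] [Algebra F K] : Prop :=
  ∃ (k n : ℕ) (b : Basis (Fin n) F V) (G : Matrix (Fin k) (Fin n) K), M.IsRepresentedBy b G

/-- `M` is representable: it is representable over some extension field of `F`. -/
def QMatroid.Representable {F : Type u} {V : Type v} [Field F] [AddCommGroup V] [Module F V]
    (M : QMatroid F V) : Prop :=
  ∃ (K : Type u) (_ : Field K) (_ : Algebra F K), M.RepresentableOver K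

/-- Every subspace contains an independent subspace of the same rank. -/
theorem QMatroid.exists_indep {F V : Type*} [Field F] [AddCommGroup V] [Module F V]
    [FiniteDimensional F V] (M : QMatroid F V) (A : Submodule F V) :
    ∃ B ≤ A, M.Indep B ∧ M.rank A = finrank F B := by
  classical
  -- an independent subspace of `A` of the largest dimension
  obtain ⟨B, ⟨hBA, hB⟩, hmax⟩ : ∃ B, (B ≤ A ∧ M.Indep B) ∧
      ∀ C, (C ≤ A ∧ M.Indep C) → finrank F C ≤ finrank F B := by
    let P : ℕ → Prop := fun d => ∃ C, (C ≤ A ∧ M.Indep C) ∧ finrank F C = d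
    have h0 : P 0 := ⟨⊥, ⟨bot_le, by
      have := M.rank_le ⊥
      simp only [finrank_bot] at this
      simp [QMatroid.Indep]; omega⟩, finrank_bot F V⟩
    have hb : ∀ d, P d → d ≤ finrank F V := by
      rintro d ⟨C, -, rfl⟩
      exact C.finrank_le
    obtain ⟨B, h1, h2⟩ := Nat.findGreatest_spec (P := P) (Nat.zero_le (finrank F V)) h0
    refine ⟨B, h1, fun C hC => ?_⟩
    rw [h2]
    exact Nat.le_findGreatest (hb _ ⟨C, hC, rfl⟩) ⟨C, hC, rfl⟩
  have hstep : ∀ a ∈ A, M.rank (B ⊔ Submodule.span F {a}) ≤ M.rank B := by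
    intro a ha
    by_contra hlt
    push Not at hlt
    have h1 : finrank F ↥(B ⊔ Submodule.span F {a}) ≤ finrank F B + 1 := by
      have h2 := Submodule.finrank_add_le_finrank_add_finrank B (Submodule.span F {a})
      have h3 := finrank_span_le_card (R := F) ({a} : Set V)
      simp at h3
      omega
    have h4 := M.rank_le (B ⊔ Submodule.span F {a})
    have hB' : M.rank B = finrank F B := hB
    have h5 := hmax (B ⊔ Submodule.span F {a})
      ⟨sup_le hBA (by simpa using ha), by unfold QMatroid.Indep; omega⟩
    omega
  -- a subspace between `B` and `A` of the same rank as `B`, of the largest dimension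
  obtain ⟨C, ⟨hBC, hCA, hC⟩, hCmax⟩ : ∃ C, (B ≤ C ∧ C ≤ A ∧ M.rank C ≤ M.rank B) ∧
      ∀ D, (B ≤ D ∧ D ≤ A ∧ M.rank D ≤ M.rank B) → finrank F D ≤ finrank F C := by
    let P : ℕ → Prop := fun d =>
      ∃ C, (B ≤ C ∧ C ≤ A ∧ M.rank C ≤ M.rank B) ∧ finrank F C = d
    have h0 : P (finrank F B) := ⟨B, ⟨le_rfl, hBA, le_rfl⟩, rfl⟩
    have hb : ∀ d, P d → d ≤ finrank F V := by
      rintro d ⟨C, -, rfl⟩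
      exact C.finrank_le
    obtain ⟨C, h1, h2⟩ := Nat.findGreatest_spec (P := P) (hb _ h0) h0
    refine ⟨C, h1, fun D hD => ?_⟩
    rw [h2]
    exact Nat.le_findGreatest (hb _ ⟨D, hD, rfl⟩) ⟨D, hD, rfl⟩
  have hAC : A ≤ C := by
    intro a ha
    by_contra haC
    have h1 := M.submod C (B ⊔ Submodule.span F {a})
    have h2 := hstep a ha
    have h3 : C ⊔ (B ⊔ Submodule.span F {a}) = C ⊔ Submodule.span F {a} := by
      rw [← sup_assoc, sup_eq_left.2 hBC]
    have h4 := M.mono B (C ⊓ (B ⊔ Submodule.span F {a})) (le_inf hBC le_sup_left)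
    rw [h3] at h1
    have h5 := hCmax (C ⊔ Submodule.span F {a})
      ⟨hBC.trans le_sup_left, sup_le hCA (by simpa using ha), by omega⟩
    have h6 : C < C ⊔ Submodule.span F {a} := by
      refine lt_of_le_of_ne le_sup_left fun h => haC ?_
      rw [h]
      exact Submodule.mem_sup_right (Submodule.mem_span_singleton_self a)
    have := Submodule.finrank_lt_finrank_of_lt h6
    omega
  have hCeq : C = A := le_antisymm hCA hAC
  subst hCeq
  have hB' : M.rank B = finrank F B := hB
  exact ⟨B, hBA, hB, le_antisymm (by omega) (by have := M.mono B C hBC; omega)⟩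

open Classical in
/-- The number of members of the family `X` that do not contain `A`. -/
noncomputable def avoidCount {F V : Type*} [Field F] [AddCommGroup V] [Module F V] {k : ℕ}
    (X : Fin k → Submodule F V) (A : Submodule F V) : ℕ :=
  (Finset.univ.filter fun i => ¬ A ≤ X i).card

theorem avoidCount_mono {F V : Type*} [Field F] [AddCommGroup V] [Module F V] {k : ℕ}
    (X : Fin k → Submodule F V) {A B : Submodule F V} (h : A ≤ B) :
    avoidCount X A ≤ avoidCount X B := by
  classical
  unfold avoidCount
  refine Finset.card_le_card fun i => ?_
  simp only [Finset.mem_filter, Finset.mem_univ, true_and]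
  exact fun h1 h2 => h1 (h.trans h2)

theorem avoidCount_submod {F V : Type*} [Field F] [AddCommGroup V] [Module F V] {k : ℕ}
    (X : Fin k → Submodule F V) (A B : Submodule F V) :
    avoidCount X (A ⊔ B) + avoidCount X (A ⊓ B) ≤ avoidCount X A + avoidCount X B := by
  classical
  unfold avoidCount
  rw [← Finset.card_union_add_card_inter (Finset.univ.filter fun i => ¬ A ≤ X i)]
  refine add_le_add (Finset.card_le_card fun i => ?_) (Finset.card_le_card fun i => ?_)
  · simp only [Finset.mem_filter, Finset.mem_union, Finset.mem_univ, true_and, sup_le_iff]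
    tauto
  · simp only [Finset.mem_filter, Finset.mem_inter, Finset.mem_univ, true_and]
    exact fun h => ⟨fun h' => h (inf_le_left.trans h'), fun h' => h (inf_le_right.trans h')⟩

/-- The `q`-matroid induced by the submodular function `avoidCount X`. -/
noncomputable def avoidMatroid {F V : Type*} [Field F] [AddCommGroup V] [Module F V]
    [FiniteDimensional F V] {k : ℕ} (X : Fin k → Submodule F V) : QMatroid F V :=
  have key : ∀ A : Submodule F V, ∃ B ≤ A,
      sInf {d | ∃ B ≤ A, d = avoidCount X B + (finrank F A - finrank F B)} =
        avoidCount X B + (finrank F A - finrank F B) := fun A => by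
    obtain ⟨B, h1, h2⟩ := Nat.sInf_mem
      (s := {d | ∃ B ≤ A, d = avoidCount X B + (finrank F A - finrank F B)})
      ⟨_, A, le_rfl, rfl⟩
    exact ⟨B, h1, h2⟩
  have le : ∀ A B : Submodule F V, B ≤ A →
      sInf {d | ∃ B ≤ A, d = avoidCount X B + (finrank F A - finrank F B)} ≤
        avoidCount X B + (finrank F A - finrank F B) := fun A B h => Nat.sInf_le ⟨B, h, rfl⟩
  { rank := fun A => sInf {d | ∃ B ≤ A, d = avoidCount X B + (finrank F A - finrank F B)}
    rank_le := fun A => by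
      refine (le A ⊥ bot_le).trans ?_
      simp [avoidCount]
    mono := fun A A' hA => by
      obtain ⟨B, h1, h2⟩ := key A'
      refine (le A (A ⊓ B) inf_le_left).trans ?_
      rw [h2]
      have h3 := avoidCount_mono X (inf_le_right : A ⊓ B ≤ B)
      have h4 := Submodule.finrank_sup_add_finrank_inf_eq A B
      have h5 := Submodule.finrank_mono (sup_le hA h1)
      have h6 := Submodule.finrank_mono h1
      have h7 := Submodule.finrank_mono (inf_le_left : A ⊓ B ≤ A)
      omega
    submod := fun A A' => by
      obtain ⟨B, h1, h2⟩ := key A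
      obtain ⟨B', h1', h2'⟩ := key A'
      refine (add_le_add (le (A ⊔ A') (B ⊔ B') (sup_le_sup h1 h1'))
        (le (A ⊓ A') (B ⊓ B') (inf_le_inf h1 h1'))).trans ?_
      rw [h2, h2']
      have h3 := avoidCount_submod X B B'
      have h4 := Submodule.finrank_sup_add_finrank_inf_eq A A'
      have h5 := Submodule.finrank_sup_add_finrank_inf_eq B B'
      have h6 := Submodule.finrank_mono h1
      have h7 := Submodule.finrank_mono h1'
      have h8 := Submodule.finrank_mono (sup_le_sup h1 h1')
      have h9 := Submodule.finrank_mono (inf_le_inf h1 h1')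
      omega }

theorem avoidMatroid_indep_iff {F V : Type*} [Field F] [AddCommGroup V] [Module F V]
    [FiniteDimensional F V] {k : ℕ} (X : Fin k → Submodule F V) (T : Submodule F V) :
    (avoidMatroid X).Indep T ↔ ∀ B ≤ T, finrank F B ≤ avoidCount X B := by
  have hne : {d | ∃ B ≤ T, d = avoidCount X B + (finrank F T - finrank F B)}.Nonempty :=
    ⟨_, T, le_rfl, rfl⟩
  constructor
  · intro h B hB
    have h1 : (avoidMatroid X).rank T = finrank F T := h
    have h2 : (avoidMatroid X).rank T ≤ avoidCount X B + (finrank F T - finrank F B) :=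
      Nat.sInf_le ⟨B, hB, rfl⟩
    have h3 := Submodule.finrank_mono hB
    omega
  · intro h
    refine le_antisymm ((avoidMatroid X).rank_le T) ?_
    obtain ⟨B, hB, h2⟩ := Nat.sInf_mem hne
    have h3 : (avoidMatroid X).rank T = avoidCount X B + (finrank F T - finrank F B) := h2
    have := h B hB
    omega

/-- The partial `q`-transversals are the independent subspaces of the induced `q`-matroid. -/
theorem isPartialQTransversal_iff {F V : Type*} [Field F] [AddCommGroup V] [Module F V]
    [FiniteDimensional F V] {k : ℕ} (X : Fin k → Submodule F V) (T : Submodule F V) :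
    IsPartialQTransversal X T ↔ (avoidMatroid X).Indep T := by
  classical
  rw [avoidMatroid_indep_iff]
  constructor
  · intro h B hB
    let v : Fin (finrank F B) → T := fun i => ⟨finBasis F B i, hB (finBasis F B i).2⟩
    have hv : LinearIndependent F v := by
      have h1 : LinearIndependent F (Submodule.inclusion hB ∘ finBasis F B) :=
        (finBasis F B).linearIndependent.map' _ (Submodule.ker_inclusion _ _ hB)
      exact h1
    let c := Basis.sumExtend hv
    have : Fintype (Fin (finrank F B) ⊕ Basis.sumExtendIndex hv) :=
      FiniteDimensional.fintypeBasisIndex c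
    let e := Fintype.equivFinOfCardEq (finrank_eq_card_basis c).symm
    obtain ⟨p, hp, hpX⟩ := h (c.reindex e)
    have hmem : ∀ j, p (e (Sum.inl j)) ∈ Finset.univ.filter fun i => ¬ B ≤ X i := by
      intro j
      simp only [Finset.mem_filter, Finset.mem_univ, true_and]
      intro hle
      have h1 := hpX (e (Sum.inl j))
      rw [Basis.reindex_apply, Equiv.symm_apply_apply] at h1
      have h2 : c (Sum.inl j) = v j := by
        simp only [c, Basis.sumExtend, Basis.reindex_apply, Basis.extend_apply_self]
        rfl
      rw [h2] at h1
      exact h1 (hle (finBasis F B j).2)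
    have := Finset.card_le_card_of_injOn (s := (Finset.univ : Finset (Fin (finrank F B))))
      (fun j => p (e (Sum.inl j))) (fun j _ => hmem j)
      (fun i _ j _ hij => Sum.inl_injective (e.injective (hp hij)))
    simpa [avoidCount] using this
  · intro h B
    obtain ⟨p, hp, hpX⟩ := (Finset.all_card_le_biUnion_card_iff_exists_injective
      (fun j => Finset.univ.filter fun i => (B j : V) ∉ X i)).1 (by
        intro s
        have hli : LinearIndependent F fun j : s => (B j : V) :=
          (B.linearIndependent.map' T.subtype (Submodule.ker_subtype T)).comp _
            Subtype.val_injective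
        have h1 := finrank_span_eq_card hli
        have h2 := h (Submodule.span F (Set.range fun j : s => (B j : V)))
          (Submodule.span_le.2 (by rintro _ ⟨j, rfl⟩; exact (B j).2))
        rw [h1] at h2
        simp only [Fintype.card_coe] at h2
        refine h2.trans (Finset.card_le_card fun i => ?_)
        simp only [Finset.mem_filter, Finset.mem_univ, true_and, Finset.mem_biUnion]
        intro h3
        by_contra h4
        push Not at h4
        refine h3 (Submodule.span_le.2 ?_)
        rintro _ ⟨j, rfl⟩
        exact h4 j j.2)
    exact ⟨p, hp, fun j => by simpa using hpX j⟩

/-- The largest dimension of a partial `q`-transversal of `X` contained in `A`. -/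
noncomputable def partialQTransversalRank {F V : Type*} [Field F] [AddCommGroup V] [Module F V]
    {k : ℕ} (X : Fin k → Submodule F V) (A : Submodule F V) : ℕ :=
  sSup {d | ∃ T ≤ A, IsPartialQTransversal X T ∧ finrank F T = d}

theorem partialQTransversalRank_eq {F V : Type*} [Field F] [AddCommGroup V] [Module F V]
    [FiniteDimensional F V] {k : ℕ} (X : Fin k → Submodule F V) (A : Submodule F V) :
    partialQTransversalRank X A = (avoidMatroid X).rank A := by
  obtain ⟨B, hBA, hB, h⟩ := (avoidMatroid X).exists_indep A
  have hub : ∀ d ∈ {d | ∃ T ≤ A, IsPartialQTransversal X T ∧ finrank F T = d},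
      d ≤ (avoidMatroid X).rank A := by
    rintro d ⟨T, hTA, hT, rfl⟩
    have h1 : (avoidMatroid X).rank T = finrank F T := (isPartialQTransversal_iff X T).1 hT
    rw [← h1]
    exact (avoidMatroid X).mono T A hTA
  have hmem : (avoidMatroid X).rank A ∈
      {d | ∃ T ≤ A, IsPartialQTransversal X T ∧ finrank F T = d} :=
    ⟨B, hBA, (isPartialQTransversal_iff X B).2 hB, h.symm⟩
  exact le_antisymm (csSup_le ⟨_, hmem⟩ hub) (le_csSup ⟨_, hub⟩ hmem)

/-- The `q`-transversal matroid of the family `X`: the rank of `A` is the largest dimension of a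
partial `q`-transversal contained in `A`. -/
noncomputable def qTransversalMatroid {F V : Type*} [Field F] [AddCommGroup V] [Module F V]
    [FiniteDimensional F V] {k : ℕ} (X : Fin k → Submodule F V) : QMatroid F V where
  rank := partialQTransversalRank X
  rank_le := fun A => by
    rw [partialQTransversalRank_eq]
    exact (avoidMatroid X).rank_le A
  mono := fun A B h => by
    rw [partialQTransversalRank_eq, partialQTransversalRank_eq]
    exact (avoidMatroid X).mono A B h
  submod := fun A B => by
    simp only [partialQTransversalRank_eq]
    exact (avoidMatroid X).submod A B

/-- The independent subspaces of the `q`-transversal matroid are the partial `q`-transversals. -/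
theorem qTransversalMatroid_indep_iff {F V : Type*} [Field F] [AddCommGroup V] [Module F V]
    [FiniteDimensional F V] {k : ℕ} (X : Fin k → Submodule F V) (T : Submodule F V) :
    (qTransversalMatroid X).Indep T ↔ IsPartialQTransversal X T := by
  rw [isPartialQTransversal_iff]
  unfold QMatroid.Indep
  rw [← partialQTransversalRank_eq]
  rfl

open Classical in
/-- The `k × n` matrix with entry `0` at `(i, j)` if `j ∈ L i` and `y i ^ (j + 1)` otherwise
(columns are numbered from `0`, so `j + 1` is the usual number of the column). -/
noncomputable def alignedMatrix {K : Type*} [Field K] {k n : ℕ} (L : Fin k → Set (Fin n))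
    (y : Fin k → K) : Matrix (Fin k) (Fin n) K :=
  Matrix.of fun i j => if j ∈ L i then 0 else y i ^ ((j : ℕ) + 1)

/-! Let `f` be the `F`-linear map from `V` to `K^k` given by `G`. The rank of `G * Sᵀ` is the
`K`-dimension of the span of `f(A)`, where `A` is the row space, and it has to equal the minimum
over `B ≤ A` of `avoidCount X B + dim A - dim B`.

It is at most this for every `G` with the prescribed zeros: `f(B)` lives in the coordinates `i` with
`B` not inside `X i`, and a complement of `B` in `A` adds at most `dim A - dim B`.

Conversely, take an independent `T ≤ A` of dimension `m = r(A)` with basis `t`. Up to a common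
factor, a minor of `G` times the coordinate matrix of `t`, on rows `e`, is a sum over maps `g`
avoiding the sets `L (e i)` of the monomial `∏ y (e i) ^ g i` times a determinant over `F`. Distinct
`g` give distinct monomials, so if these are `F`-independent, nothing cancels and one nonzero
determinant suffices. Rado's theorem, applied to the coordinate functionals on `T` and the
complements of the `L i`, supplies it; independence of `T` is its hypothesis.

The monomials are independent for variables `y i`, and for `y i = α ^ n ^ i` by uniqueness of
base-`n` digits. -/

/-! ### Rado's theorem -/

/-- Rado's theorem with a defect, for a monotone submodular function: a family of nonempty finite
sets whose unions have rank at least their number minus `d` has a choice function whose values have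
rank at least the number of sets minus `d`. -/
theorem exists_choice_of_card_le_rank_biUnion {α ι : Type*} [DecidableEq α] [Fintype ι]
    (r : Finset α → ℕ) (hmono : ∀ s t, s ⊆ t → r s ≤ r t)
    (hsub : ∀ s t, r (s ∪ t) + r (s ∩ t) ≤ r s + r t) (d : ℕ) (A : ι → Finset α)
    (hne : ∀ i, (A i).Nonempty) (h : ∀ J : Finset ι, J.card ≤ r (J.biUnion A) + d) :
    ∃ c : ι → α, (∀ i, c i ∈ A i) ∧ Fintype.card ι ≤ r (Finset.univ.image c) + d := by
  classical
  -- The sets are shrunk one element at a time, preserving the condition, until all are singletons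
  -- and the choice is forced.
  induction hN : ∑ i, (A i).card using Nat.strong_induction_on generalizing A with
  | _ N ih =>
  by_cases hone : ∀ i, (A i).card = 1
  · choose c hc using fun i => Finset.card_eq_one.1 (hone i)
    refine ⟨c, fun i => by simp [hc], (h Finset.univ).trans_eq ?_⟩
    congr 2
    ext x
    simp [hc, eq_comm]
  push Not at hone
  obtain ⟨i, hi⟩ := hone
  obtain ⟨x, hx, y, hy, hxy⟩ := Finset.one_lt_card.1
    (lt_of_le_of_ne (Finset.card_pos.2 (hne i)) (Ne.symm hi))
  -- removing `z` from `A i` either keeps the condition or violates it for a family through `i`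
  have step : ∀ z ∈ A i, (A i).card ≠ 1 →
      (∃ c : ι → α, (∀ i, c i ∈ A i) ∧ Fintype.card ι ≤ r (Finset.univ.image c) + d) ∨
      ∃ J : Finset ι, i ∉ J ∧ r ((A i).erase z ∪ J.biUnion A) + d < J.card + 1 := by
    intro z hz h1
    set A' := Function.update A i ((A i).erase z) with hA'
    have hsubset : ∀ j, A' j ⊆ A j := by
      intro j
      by_cases hj : j = i
      · subst hj; simpa [hA'] using Finset.erase_subset _ _
      · simp [hA', hj]
    by_cases hcond : ∀ J : Finset ι, J.card ≤ r (J.biUnion A') + d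
    · left
      obtain ⟨c, hc, hcr⟩ := ih (∑ j, (A' j).card) (by
        rw [← hN]
        refine Finset.sum_lt_sum (fun j _ => Finset.card_le_card (hsubset j)) ⟨i, by simp, ?_⟩
        simpa [hA'] using Finset.card_erase_lt_of_mem hz) A' (by
          intro j
          by_cases hj : j = i
          · subst hj
            have h2 := Finset.card_pos.2 (hne j)
            have h3 := Finset.card_erase_of_mem hz
            simp only [hA', Function.update_self]
            exact Finset.card_pos.1 (by omega)
          · simpa [hA', hj] using hne j) hcond rfl
      exact ⟨c, fun j => hsubset j (hc j), hcr⟩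
    · right
      push Not at hcond
      obtain ⟨J, hJ⟩ := hcond
      have hcongr : (J.erase i).biUnion A' = (J.erase i).biUnion A :=
        Finset.biUnion_congr rfl fun j hj => by simp [hA', (Finset.mem_erase.1 hj).1]
      have hiJ : i ∈ J := by
        by_contra hiJ
        rw [Finset.erase_eq_of_notMem hiJ] at hcongr
        have := h J
        rw [hcongr] at hJ
        omega
      refine ⟨J.erase i, by simp, ?_⟩
      have h2 : J.biUnion A' = (A i).erase z ∪ (J.erase i).biUnion A := by
        rw [← hcongr]
        conv_lhs => rw [← Finset.insert_erase hiJ, Finset.biUnion_insert]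
        simp [hA']
      rw [Finset.card_erase_add_one hiJ, ← h2]
      exact hJ
  obtain hc | ⟨J₁, hi₁, h₁⟩ := step x hx hi
  · exact hc
  obtain hc | ⟨J₂, hi₂, h₂⟩ := step y hy hi
  · exact hc
  exfalso
  -- Submodularity bounds the ranks of the union and the intersection by `|J₁| + |J₂| - 2d` in
  -- total. As `x ≠ y`, the union recovers all of `A i`, so the condition for `insert i (J₁ ∪ J₂)`
  -- and `J₁ ∩ J₂` demands one more than that.
  have hs := hsub ((A i).erase x ∪ J₁.biUnion A) ((A i).erase y ∪ J₂.biUnion A)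
  have hu := hmono ((insert i (J₁ ∪ J₂)).biUnion A)
    (((A i).erase x ∪ J₁.biUnion A) ∪ ((A i).erase y ∪ J₂.biUnion A)) (by
      intro a
      simp only [Finset.mem_biUnion, Finset.mem_insert, Finset.mem_union, Finset.mem_erase]
      rintro ⟨j, rfl | hj | hj, ha⟩
      · by_cases hax : a = x
        · exact .inr (.inl ⟨hax ▸ hxy, ha⟩)
        · exact .inl (.inl ⟨hax, ha⟩)
      · exact .inl (.inr ⟨j, hj, ha⟩)
      · exact .inr (.inr ⟨j, hj, ha⟩))
  have hn := hmono ((J₁ ∩ J₂).biUnion A)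
    (((A i).erase x ∪ J₁.biUnion A) ∩ ((A i).erase y ∪ J₂.biUnion A)) (by
      intro a
      simp only [Finset.mem_biUnion, Finset.mem_inter, Finset.mem_union]
      rintro ⟨j, ⟨hj1, hj2⟩, ha⟩
      exact ⟨.inr ⟨j, hj1, ha⟩, .inr ⟨j, hj2, ha⟩⟩)
  have hJ := h (insert i (J₁ ∪ J₂))
  have hJ' := h (J₁ ∩ J₂)
  rw [Finset.card_insert_of_notMem (by simp [hi₁, hi₂])] at hJ
  have := Finset.card_union_add_card_inter J₁ J₂
  omega

/-! ### Spans of images and the upper bound for the rank -/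

/-- Submodularity of the rank function of a family of vectors. -/
theorem finrank_span_image_submod {F W α : Type*} [Field F] [AddCommGroup W] [Module F W]
    [FiniteDimensional F W] [DecidableEq α] (v : α → W) (s t : Finset α) :
    finrank F (Submodule.span F (v '' (s ∪ t : Finset α))) +
        finrank F (Submodule.span F (v '' (s ∩ t : Finset α))) ≤
      finrank F (Submodule.span F (v '' s)) + finrank F (Submodule.span F (v '' t)) := by
  rw [← Submodule.finrank_sup_add_finrank_inf_eq (Submodule.span F (v '' s)), Finset.coe_union,
    Set.image_union, Submodule.span_union]
  refine Nat.add_le_add_left (Submodule.finrank_mono (le_inf ?_ ?_)) _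
  · exact Submodule.span_mono (Set.image_mono (by simp))
  · exact Submodule.span_mono (Set.image_mono (by simp))

/-- The image of an `F`-span under an `F`-linear map into a `K`-space has the same `K`-span as the
image of the generators. -/
theorem span_image_span_eq {F K V W : Type*} [Field F] [Field K] [Algebra F K] [AddCommGroup V]
    [Module F V] [AddCommGroup W] [Module F W] [Module K W] [IsScalarTower F K W]
    (f : V →ₗ[F] W) (s : Set V) :
    Submodule.span K (f '' (Submodule.span F s : Set V)) = Submodule.span K (f '' s) := by
  refine le_antisymm (Submodule.span_le.2 ?_)
    (Submodule.span_mono (Set.image_mono Submodule.subset_span))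
  rintro _ ⟨x, hx, rfl⟩
  have h : f x ∈ Submodule.span F (f '' s) := by
    rw [Submodule.span_image]
    exact Submodule.mem_map_of_mem hx
  exact Submodule.span_le_restrictScalars F K _ h

/-- The rank of `G * Sᵀ` is the dimension of the `K`-span of the image of the row space of `S` under
the linear map given by `G`. -/
theorem rank_mul_transpose_map {F V K : Type*} [Field F] [AddCommGroup V] [Module F V]
    [Field K] [Algebra F K] {k n m : ℕ} (b : Basis (Fin n) F V) (G : Matrix (Fin k) (Fin n) K)
    (S : Matrix (Fin m) (Fin n) F) :
    (G * (S.map (algebraMap F K)).transpose).rank =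
      finrank K (Submodule.span K (b.constr F G.col ''
        (Submodule.span F (Set.range fun i => b.equivFun.symm (S i)) : Set V))) := by
  have h : (G * (S.map (algebraMap F K)).transpose).col =
      b.constr F G.col ∘ fun i => b.equivFun.symm (S i) := by
    ext j i
    simp [Matrix.mul_apply, Algebra.smul_def, mul_comm]
  rw [span_image_span_eq, Matrix.rank_eq_finrank_span_cols, ← Set.range_comp, h]

/-- A linear map into a `K`-space whose `i`-th coordinate vanishes on `X i` maps `A` to a set of
rank at most the rank of `A` in the matroid of the family `X`. -/
theorem finrank_span_image_le_avoidMatroid_rank {F V K : Type*} [Field F] [AddCommGroup V]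
    [Module F V] [FiniteDimensional F V] [Field K] [Algebra F K] {k : ℕ}
    (X : Fin k → Submodule F V) (f : V →ₗ[F] (Fin k → K)) (hf : ∀ i, ∀ x ∈ X i, f x i = 0)
    (A : Submodule F V) :
    finrank K (Submodule.span K (f '' (A : Set V))) ≤ (avoidMatroid X).rank A := by
  classical
  obtain ⟨B, hBA, hB⟩ := Nat.sInf_mem
    (s := {d | ∃ B ≤ A, d = avoidCount X B + (finrank F A - finrank F B)})
    ⟨_, A, le_rfl, rfl⟩
  change _ ≤ sInf _
  rw [hB]
  obtain ⟨C, hBC, hdisj⟩ : ∃ C, B ⊔ C = A ∧ Disjoint B C := by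
    obtain ⟨C, hC⟩ := exists_isCompl B
    refine ⟨C ⊓ A, ?_, hC.disjoint.mono_right inf_le_left⟩
    rw [← sup_inf_assoc_of_le C hBA, hC.sup_eq_top, top_inf_eq]
  have hdim := Submodule.finrank_sup_add_finrank_inf_eq B C
  rw [hBC, hdisj.eq_bot, finrank_bot] at hdim
  have hsplit : Submodule.span K (f '' (A : Set V)) =
      Submodule.span K (f '' (B : Set V)) ⊔ Submodule.span K (f '' (C : Set V)) := by
    have : A = Submodule.span F ((B : Set V) ∪ C) := by
      rw [Submodule.span_union, Submodule.span_eq, Submodule.span_eq, hBC]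
    rw [this, span_image_span_eq, Set.image_union, Submodule.span_union]
  have hC : finrank K (Submodule.span K (f '' (C : Set V))) ≤ finrank F C := by
    have h1 : C = Submodule.span F (Set.range fun i => (finBasis F C i : V)) := by
      have := congrArg (Submodule.map C.subtype) (finBasis F C).span_eq
      rw [Submodule.map_span, ← Set.range_comp, Submodule.map_top, Submodule.range_subtype] at this
      exact this.symm
    conv_lhs => rw [h1, span_image_span_eq, ← Set.range_comp]
    exact (finrank_range_le_card _).trans_eq (Fintype.card_fin _)
  have hB' : finrank K (Submodule.span K (f '' (B : Set V))) ≤ avoidCount X B := by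
    -- Coordinates outside `s` vanish on `f(B)`, so restriction to `s` is injective on its span.
    let s := Finset.univ.filter fun i => ¬ B ≤ X i
    let g : (Fin k → K) →ₗ[K] (s → K) := LinearMap.funLeft K K Subtype.val
    have hinj : Function.Injective
        (g.domRestrict (Submodule.span K (f '' (B : Set V)))) := by
      rw [← LinearMap.ker_eq_bot, LinearMap.ker_eq_bot']
      rintro ⟨x, hx⟩ hgx
      have hz : Submodule.span K (f '' (B : Set V)) ≤
          Submodule.pi ((s : Set (Fin k))ᶜ) fun _ => ⊥ := by
        rw [Submodule.span_le]
        rintro _ ⟨y, hy, rfl⟩ i hi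
        have hi' : B ≤ X i := by simpa [s] using hi
        exact hf i y (hi' hy)
      ext i
      by_cases hi : i ∈ s
      · exact congrFun hgx ⟨i, hi⟩
      · exact hz hx i (by simpa using hi)
    have := LinearMap.finrank_le_finrank_of_injective hinj
    rwa [finrank_fintype_fun_eq_card, Fintype.card_coe] at this
  rw [hsplit]
  have := Submodule.finrank_add_le_finrank_add_finrank (Submodule.span K (f '' (B : Set V)))
    (Submodule.span K (f '' (C : Set V)))
  omega

/-! ### A nonsingular minor from Rado's theorem -/

/-- The coordinates of a basis of an independent subspace have a nonsingular square submatrix whose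
columns are matched with distinct members of the family. -/
theorem exists_injective_linearIndependent_coord {F V : Type*} [Field F] [AddCommGroup V]
    [Module F V] [FiniteDimensional F V] {n k m : ℕ} (b : Basis (Fin n) F V)
    (L : Fin k → Set (Fin n)) (X : Fin k → Submodule F V)
    (hX : ∀ i, X i = Submodule.span F (b '' L i)) (T : Submodule F V)
    (hT : (avoidMatroid X).Indep T) (t : Basis (Fin m) F T) :
    ∃ (e : Fin m → Fin k) (l : Fin m → Fin n), Function.Injective e ∧ (∀ i, l i ∉ L (e i)) ∧
      LinearIndependent F fun i j => b.repr (t j) (l i) := by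
  classical
  rw [avoidMatroid_indep_iff] at hT
  have hm : finrank F T = m := by simp [finrank_eq_card_basis t]
  have hmk : m ≤ k := by
    rw [← hm]
    refine (hT T le_rfl).trans ?_
    simpa [avoidCount] using Finset.card_filter_le (Finset.univ : Finset (Fin k)) (¬ T ≤ X ·)
  -- the coordinate functionals on `T`, together with `0`
  let v : Option (Fin n) → Fin m → F := fun o => o.elim 0 fun l j => b.repr (t j) l
  -- The zero functional keeps every set nonempty, even if `L i` is everything, without changing any
  -- rank.
  let A : Fin k → Finset (Option (Fin n)) := fun i =>
    insert none ((Finset.univ.filter (· ∉ L i)).image some)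
  -- With defect `k - m`, the `k` chosen functionals have rank at least `m`.
  obtain ⟨c, hc, hck⟩ := exists_choice_of_card_le_rank_biUnion
    (fun s : Finset (Option (Fin n)) => finrank F (Submodule.span F (v '' s)))
    (fun s s' h => Submodule.finrank_mono (Submodule.span_mono (Set.image_mono h)))
    (finrank_span_image_submod v) (k - m) A (fun i => Finset.insert_nonempty _ _) (by
      intro J
      let N : Matrix (J.biUnion A) (Fin m) F := Matrix.of fun a => v a
      have hN : N.rank = finrank F (Submodule.span F (v '' (J.biUnion A : Finset _))) := by
        rw [Matrix.rank_eq_finrank_span_row, Set.image_eq_range]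
        rfl
      have hker := N.mulVecLin.finrank_range_add_finrank_ker
      change N.rank + _ = _ at hker
      rw [finrank_fintype_fun_eq_card, Fintype.card_fin] at hker
      let φ : (Fin m → F) →ₗ[F] V := T.subtype ∘ₗ t.equivFun.symm.toLinearMap
      have hφ : Function.Injective φ := T.subtype_injective.comp t.equivFun.symm.injective
      -- `B` is the part of `T` killed by all coordinates offered to `J`. It lies in `X i` for every
      -- `i` in `J`, so `m - N.rank = dim B ≤ avoidCount X B ≤ k - |J|`, which is the condition on
      -- `J`.
      let B := (LinearMap.ker N.mulVecLin).map φ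
      have hB : finrank F B = finrank F (LinearMap.ker N.mulVecLin) :=
        (Submodule.equivMapOfInjective φ hφ _).finrank_eq.symm
      have hBT : B ≤ T := by
        rintro _ ⟨w, -, rfl⟩
        exact (t.equivFun.symm w).2
      have hBX : ∀ i ∈ J, B ≤ X i := by
        rintro i hi _ ⟨w, hw, rfl⟩
        rw [hX, Basis.mem_span_image]
        intro l hl
        by_contra hlL
        refine (Finsupp.mem_support_iff.1 hl) ?_
        have hmem : some l ∈ J.biUnion A :=
          Finset.mem_biUnion.2 ⟨i, hi, by simpa [A] using hlL⟩
        have := congrFun (LinearMap.mem_ker.1 hw) ⟨some l, hmem⟩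
        simpa [φ, N, v, Matrix.mulVec, dotProduct, Basis.equivFun_symm_apply, mul_comm] using this
      have hcount : avoidCount X B + J.card ≤ k := by
        unfold avoidCount
        rw [← Finset.card_union_of_disjoint]
        · simpa using Finset.card_le_univ ((Finset.univ.filter fun i => ¬ B ≤ X i) ∪ J)
        · rw [Finset.disjoint_left]
          intro i hi hiJ
          exact (Finset.mem_filter.1 hi).2 (hBX i hiJ)
      have := hT B hBT
      omega)
  -- An independent subfamily spanning the same space has exactly `m` members, as the functionals
  -- live in `F^m`, and it omits the zero functional.
  obtain ⟨κ, a, ha, hspan, hli⟩ := exists_linearIndependent' F (v ∘ c)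
  have : Finite κ := Finite.of_injective a ha
  have := Fintype.ofFinite κ
  have hκ : Fintype.card κ = m := by
    have h1 := finrank_span_eq_card hli
    have h2 := Submodule.finrank_le (Submodule.span F (Set.range (v ∘ c)))
    rw [finrank_fintype_fun_eq_card, Fintype.card_fin] at h2
    rw [Fintype.card_fin, Finset.coe_image, Finset.coe_univ, Set.image_univ,
      ← Set.range_comp] at hck
    rw [hspan] at h1
    omega
  let ε := Fintype.equivFinOfCardEq hκ
  have hsome : ∀ i, ∃ l, c (a (ε.symm i)) = some l := by
    intro i
    refine Option.ne_none_iff_exists'.1 fun h => hli.ne_zero (ε.symm i) ?_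
    simp [h, v]
  choose l hl using hsome
  refine ⟨a ∘ ε.symm, l, ha.comp ε.symm.injective, fun i => ?_, ?_⟩
  · have := hc (a (ε.symm i))
    simpa [A, hl] using this
  · have h : (fun i j => b.repr (t j) (l i)) = ((v ∘ c) ∘ a) ∘ ε.symm := by
      funext i
      simp [hl, v]
    rw [h]
    exact hli.comp ε.symm ε.symm.injective

/-! ### Expansion of the minor and the representation criterion -/

/-- The determinant of a product `P * Q`, expanded along the rows of `P`. -/
theorem det_mul_eq_sum_prod_mul_det {R : Type*} [CommRing R] {m n : ℕ}
    (P : Matrix (Fin m) (Fin n) R) (Q : Matrix (Fin n) (Fin m) R) :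
    (P * Q).det = ∑ g : Fin m → Fin n, (∏ i, P i (g i)) * (Q.submatrix g id).det := by
  have h : P * Q = fun i => ∑ l, P i l • Q l := by
    ext i j
    simp [Matrix.mul_apply]
  rw [h]
  refine ((Matrix.detRowAlternating (R := R) (n := Fin m)).toMultilinearMap.map_sum
    (g := fun i l => P i l • Q l)).trans (Finset.sum_congr rfl fun g _ => ?_)
  exact (Matrix.detRowAlternating (R := R) (n := Fin m)).toMultilinearMap.map_smul_univ
    (fun i => P i (g i)) (fun i => Q (g i))

/-- The monomials of degree less than `n` in each of a subfamily of the `y i` are linearly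
independent if those in the whole family are. -/
theorem linearIndependent_monomials_comp {F K : Type*} [Field F] [Field K] [Algebra F K]
    {n k m : ℕ} (hn : 0 < n) {y : Fin k → K}
    (hy : LinearIndependent F fun g : Fin k → Fin n => ∏ i, y i ^ (g i : ℕ))
    {e : Fin m → Fin k} (he : Function.Injective e) :
    LinearIndependent F fun g : Fin m → Fin n => ∏ i, y (e i) ^ (g i : ℕ) := by
  -- Variables outside the range of `e` get exponent `0`, which is available because `0 < n`.
  convert hy.comp (fun g : Fin m → Fin n => Function.extend e g fun _ => ⟨0, hn⟩) ?_ using 1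
  · funext g
    refine Fintype.prod_of_injective e he _ _ (fun i hi => ?_) fun i => ?_
    · dsimp only
      rw [Function.extend_apply' _ _ _ (by simpa using hi)]
      simp
    · dsimp only
      rw [he.extend_apply]
  · intro g g' h
    funext i
    simpa [he.extend_apply] using congrFun h (e i)

/-- The matrix `alignedMatrix L y` represents the `q`-transversal matroid if the monomials of
degree less than `n` in each of the `y i` are linearly independent over `F`. -/
theorem isRepresentedBy_alignedMatrix {F V K : Type*} [Field F] [AddCommGroup V] [Module F V]
    [FiniteDimensional F V] [Field K] [Algebra F K] {n k : ℕ} (b : Basis (Fin n) F V)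
    (L : Fin k → Set (Fin n)) (X : Fin k → Submodule F V)
    (hX : ∀ i, X i = Submodule.span F (b '' L i)) (y : Fin k → K) (hy0 : ∀ i, y i ≠ 0)
    (hy : LinearIndependent F fun g : Fin k → Fin n => ∏ i, y i ^ (g i : ℕ)) :
    (qTransversalMatroid X).IsRepresentedBy b (alignedMatrix L y) := by
  classical
  intro p S
  rw [rank_mul_transpose_map b]
  set f := b.constr F (alignedMatrix L y).col with hf
  set A := Submodule.span F (Set.range fun i => b.equivFun.symm (S i))
  change partialQTransversalRank X A = _
  rw [partialQTransversalRank_eq]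
  refine le_antisymm ?_ (finrank_span_image_le_avoidMatroid_rank X f (fun i x hx => ?_) A)
  · obtain ⟨T, hTA, hT, hrank⟩ := (avoidMatroid X).exists_indep A
    rw [hrank]
    obtain ⟨m, hTm⟩ : ∃ m, finrank F T = m := ⟨_, rfl⟩
    rw [hTm]
    let t := finBasisOfFinrankEq F T hTm
    obtain ⟨e, l, he, hlL, hli⟩ := exists_injective_linearIndependent_coord b L X hX T hT t
    rcases Nat.eq_zero_or_pos m with hm | hm
    · omega
    have hn : 0 < n := (l ⟨0, hm⟩).pos
    let P : Matrix (Fin m) (Fin n) K := (alignedMatrix L y).submatrix e id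
    let Q : Matrix (Fin n) (Fin m) F := Matrix.of fun l j => b.repr (t j) l
    have hPQ : ∀ i j, (P * Q.map (algebraMap F K)) i j = f (t j) (e i) := by
      intro i j
      simp [hf, P, Q, Matrix.mul_apply, Basis.constr_apply_fintype, Algebra.smul_def, mul_comm]
    have hdet : (P * Q.map (algebraMap F K)).det ≠ 0 := by
      intro h0
      rw [det_mul_eq_sum_prod_mul_det] at h0
      -- Maps `g` that hit a zero entry of the matrix contribute nothing; the others contribute one
      -- monomial each, with coefficient in `F`.
      let coef : (Fin m → Fin n) → F := fun g =>
        if ∀ i, g i ∉ L (e i) then (Q.submatrix g id).det else 0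
      have hsum : ∑ g, coef g • ∏ i, y (e i) ^ (g i : ℕ) = 0 := by
        -- The entries have exponents `1, ..., n`; cancelling one factor `y (e i)` per row brings
        -- them down to `0, ..., n - 1`.
        refine (mul_eq_zero.1 ?_).resolve_left
          (Finset.prod_ne_zero_iff.2 fun i (_ : i ∈ Finset.univ) => hy0 (e i))
        rw [← h0, Finset.mul_sum]
        refine Finset.sum_congr rfl fun g _ => ?_
        by_cases hg : ∀ i, g i ∉ L (e i)
        · have h1 : ∏ i, P i (g i) = (∏ i, y (e i)) * ∏ i, y (e i) ^ (g i : ℕ) := by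
            rw [← Finset.prod_mul_distrib]
            refine Finset.prod_congr rfl fun i _ => ?_
            simp [P, alignedMatrix, hg i, pow_succ']
          have h2 : ((Q.map (algebraMap F K)).submatrix g id).det =
              algebraMap F K (Q.submatrix g id).det := by
            rw [RingHom.map_det]
            rfl
          rw [h1, h2]
          simp only [coef, if_pos hg, Algebra.smul_def]
          ring
        · have h1 : ∏ i, P i (g i) = 0 := by
            push Not at hg
            obtain ⟨i, hi⟩ := hg
            exact Finset.prod_eq_zero (Finset.mem_univ i) (by simp [P, alignedMatrix, hi])
          simp [coef, hg, h1]
      -- The coefficient at `l` is the nonsingular minor found by Rado's theorem, yet independence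
      -- of the monomials makes it zero.
      have h1 := Fintype.linearIndependent_iff.1 (linearIndependent_monomials_comp hn hy he) coef
        hsum l
      simp only [coef, if_pos hlL] at h1
      have h2 : LinearIndependent F (Q.submatrix l id).row := hli
      rw [Matrix.linearIndependent_rows_iff_isUnit, Matrix.isUnit_iff_isUnit_det, h1] at h2
      exact not_isUnit_zero h2
    have hind : LinearIndependent K fun j => f (t j) := by
      -- Independence may be tested on the coordinates in the range of `e`.
      refine LinearIndependent.of_comp (LinearMap.funLeft K K e) ?_
      have h1 : LinearIndependent K (P * Q.map (algebraMap F K)).col := by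
        rw [Matrix.linearIndependent_cols_iff_isUnit, Matrix.isUnit_iff_isUnit_det]
        exact hdet.isUnit
      convert h1 using 1
      funext j i
      exact (hPQ i j).symm
    have hcard := finrank_span_eq_card hind
    rw [Fintype.card_fin] at hcard
    rw [← hcard]
    refine Submodule.finrank_mono (Submodule.span_mono ?_)
    rintro _ ⟨j, rfl⟩
    exact ⟨_, hTA (t j).2, rfl⟩
  · rw [hX, Basis.mem_span_image] at hx
    rw [hf, Basis.constr_apply_fintype, Finset.sum_apply]
    refine Finset.sum_eq_zero fun j _ => ?_
    by_cases hj : j ∈ L i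
    · simp [alignedMatrix, hj]
    · have : b.repr x j = 0 := by
        by_contra h
        exact hj (hx (Finsupp.mem_support_iff.2 h))
      simp [this]

/-! ### Choices of `y` with independent monomials -/

/-- Monomials of bounded degree in algebraically independent elements are linearly independent. -/
theorem AlgebraicIndependent.linearIndependent_prod_pow {F K : Type*} [Field F] [Field K]
    [Algebra F K] {n k : ℕ} {y : Fin k → K} (hy : AlgebraicIndependent F y) :
    LinearIndependent F fun g : Fin k → Fin n => ∏ i, y i ^ (g i : ℕ) := by
  have h := ((MvPolynomial.basisMonomials (Fin k) F).linearIndependent.comp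
    (fun g : Fin k → Fin n => Finsupp.equivFunOnFinite.symm fun i => (g i : ℕ)) (by
      intro g g' h
      funext i
      exact Fin.ext (congrFun (Finsupp.equivFunOnFinite.symm.injective h) i))).map'
    (MvPolynomial.aeval y).toLinearMap (LinearMap.ker_eq_bot.2 hy)
  have heq : (fun g : Fin k → Fin n => ∏ i, y i ^ (g i : ℕ)) =
      (MvPolynomial.aeval y).toLinearMap ∘ MvPolynomial.basisMonomials (Fin k) F ∘
        fun g : Fin k → Fin n => Finsupp.equivFunOnFinite.symm fun i => (g i : ℕ) := by
    funext g
    simp [MvPolynomial.aeval_monomial, Finsupp.prod_fintype]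
  rw [heq]
  exact h

/-- The variables are algebraically independent in the field of rational functions. -/
theorem algebraicIndependent_X_fractionRing (ι F : Type*) [Field F] :
    AlgebraicIndependent F fun i : ι =>
      algebraMap (MvPolynomial ι F) (FractionRing (MvPolynomial ι F)) (MvPolynomial.X i) :=
  (MvPolynomial.algebraicIndependent_X ι F).map' (f := IsScalarTower.toAlgHom F _ _)
    (IsFractionRing.injective _ _)

/-- The products of the powers of `α ^ n ^ i` with exponents less than `n` are the powers of `α`
with exponents less than `n ^ k`, hence linearly independent if `α` has degree `n ^ k`. -/
theorem linearIndependent_prod_pow_pow {F K : Type*} [Field F] [Field K] [Algebra F K]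
    {n k : ℕ} (α : K) (hα : (minpoly F α).natDegree = n ^ k) :
    LinearIndependent F fun g : Fin k → Fin n => ∏ i : Fin k, (α ^ n ^ (i : ℕ)) ^ (g i : ℕ) := by
  have h := (linearIndependent_pow (K := F) α).comp
    (fun g : Fin k → Fin n => Fin.cast hα.symm (finFunctionFinEquiv g))
    ((Fin.cast_injective _).comp finFunctionFinEquiv.injective)
  convert h using 1
  funext g
  simp only [Function.comp_apply, Fin.val_cast, finFunctionFinEquiv_apply,
    Finset.prod_pow_eq_pow_sum, ← pow_mul, mul_comm]

/-! ### Extensions of degree `n ^ k` -/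

/-- A finite extension of a finite field is generated by a nonzero element. -/
theorem exists_ne_zero_natDegree_minpoly_eq_finrank (F K : Type*) [Field F] [Finite F] [Field K]
    [Algebra F K] [FiniteDimensional F K] :
    ∃ α : K, α ≠ 0 ∧ (minpoly F α).natDegree = finrank F K := by
  obtain ⟨α, hα⟩ := Field.exists_primitive_element F K
  have hdeg : (minpoly F α).natDegree = finrank F K :=
    (Field.primitive_element_iff_minpoly_natDegree_eq F α).1 hα
  by_cases h0 : α = 0
  -- If `0` generates, the degree is one and `1` generates as well.
  · refine ⟨1, one_ne_zero, ?_⟩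
    rw [← hdeg, h0, minpoly.zero, minpoly.one, Polynomial.natDegree_X, ← Polynomial.C_1,
      Polynomial.natDegree_X_sub_C]
  · exact ⟨α, h0, hdeg⟩

/-- A finite field has extensions of every positive degree. -/
theorem exists_field_extension_finrank_eq (F : Type u) [Field F] [Finite F] (d : ℕ) (hd : 0 < d) :
    ∃ (K : Type u) (_ : Field K) (_ : Algebra F K), finrank F K = d := by
  obtain ⟨p, hp⟩ := CharP.exists F
  have : Fact p.Prime := ⟨CharP.char_is_prime F p⟩
  have : NeZero d := ⟨hd.ne'⟩
  -- The lift places the extension in the universe of `F`.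
  exact ⟨ULift.{u} (FiniteField.Extension F p d), inferInstance, inferInstance,
    (LinearEquiv.finrank_eq ULift.moduleEquiv).trans (FiniteField.finrank_extension F p d)⟩

/-- The `q`-transversal matroid is representable over every extension of degree `n ^ k`. -/
theorem representableOver_of_finrank_eq {F V : Type*} [Field F] [Finite F] [AddCommGroup V]
    [Module F V] [FiniteDimensional F V] {n k : ℕ} (b : Basis (Fin n) F V) (L : Fin k → Set (Fin n))
    (X : Fin k → Submodule F V) (hX : ∀ i, X i = Submodule.span F (b '' L i)) (K : Type*) [Field K]
    [Algebra F K] [FiniteDimensional F K] (hK : finrank F K = n ^ k) :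
    (qTransversalMatroid X).RepresentableOver K := by
  obtain ⟨α, h0, hdeg⟩ := exists_ne_zero_natDegree_minpoly_eq_finrank F K
  exact ⟨k, n, b, _, isRepresentedBy_alignedMatrix b L X hX _ (fun i => pow_ne_zero _ h0)
    (linearIndependent_prod_pow_pow α (hdeg.trans hK))⟩

theorem mainTheorem4 {F : Type u} [Field F] [Finite F] {V : Type v} [AddCommGroup V] [Module F V]
    [FiniteDimensional F V] {n k : ℕ} (b : Basis (Fin n) F V) (L : Fin k → Set (Fin n))
    (X : Fin k → Submodule F V) (hX : ∀ i, X i = Submodule.span F (b '' L i)) :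
    -- the `q`-transversal matroid is representable
    (qTransversalMatroid X).Representable ∧
    -- it is represented by the explicit matrix over the field of rational functions
    (qTransversalMatroid X).IsRepresentedBy b
      (alignedMatrix L fun i =>
        algebraMap (MvPolynomial (Fin k) F) (FractionRing (MvPolynomial (Fin k) F))
          (MvPolynomial.X i)) ∧
    -- it is represented by the matrix in which `y i` is replaced by `α ^ (n ^ i)`
    (∀ (K : Type w) [Field K] [Algebra F K] (α : K), α ≠ 0 → IsIntegral F α →
      (minpoly F α).natDegree = n ^ k →
      (qTransversalMatroid X).IsRepresentedBy b
        (alignedMatrix L fun i => α ^ (n ^ (i : ℕ)))) ∧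
    -- it is representable over every extension of degree `n ^ k`
    (∀ (K : Type w) [Field K] [Algebra F K] [FiniteDimensional F K],
      finrank F K = n ^ k → (qTransversalMatroid X).RepresentableOver K) ∧
    -- and, if `V` is not zero, such an extension exists
    (0 < n → ∃ (K : Type u) (_ : Field K) (_ : Algebra F K),
      finrank F K = n ^ k ∧ (qTransversalMatroid X).RepresentableOver K) := by
  have hrat := isRepresentedBy_alignedMatrix b L X hX
    (fun i => algebraMap (MvPolynomial (Fin k) F) (FractionRing (MvPolynomial (Fin k) F))
      (MvPolynomial.X i))
    (fun i => by simp) (algebraicIndependent_X_fractionRing (Fin k) F).linearIndependent_prod_pow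
  refine ⟨⟨_, inferInstance, inferInstance, k, n, b, _, hrat⟩, hrat, ?_, ?_, ?_⟩
  · intro K _ _ α h0 _ hdeg
    exact isRepresentedBy_alignedMatrix b L X hX _ (fun i => pow_ne_zero _ h0)
      (linearIndependent_prod_pow_pow α hdeg)
  · intro K _ _ _ hK
    exact representableOver_of_finrank_eq b L X hX K hK
  · intro hn
    obtain ⟨K, _, _, hK⟩ := exists_field_extension_finrank_eq F (n ^ k) (pow_pos hn k)
    -- `finrank` is `0` in infinite dimension, so a positive value forces finiteness.
    have : FiniteDimensional F K := FiniteDimensional.of_finrank_pos (hK ▸ pow_pos hn k)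
    exact ⟨K, _, _, hK, representableOver_of_finrank_eq b L X hX K hK⟩
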